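/- Let $E$ be a finite-dimensional real normed space. A pattern is a function $P\colon E\to A$ into a fixed set $A$; for $U\subseteq E$ its $U$-patch at $x$ is the function $P[x,U]\colon U\to A$, $u\mapsto P(x+u)$, and for $c\ge 0$ we write $P[x,c]$ for its patch on the closed ball of radius $c$ about $0$. Put $(P+z)(x)=P(x-z)$ and, for a linear automorphism $L$ of $E$, $(LP)(x)=P(L^{-1}x)$. Let $\mathcal K_P=\{g\in E : P=P+g\}$ be the group of translational periods of $P$; $P$ is nonperiodic if $\mathcal K_P=\{0\}$. Write $Q\preceq P$ if for every compact $U\subset E$ and every $x\in E$ there is $y\in E$ with $Q[x,U]=P[y,U]$; $P$ and $Q$ are in the same LI-class if $P\preceq Q$ and $Q\preceq P$. A pattern $P$ is $L$-sub if there is a pattern $P'\preceq P$ and some $c\ge 0$ such that $(LP')[x,c]=(LP')[y,c]$ implies $P(x)=P(y)$, for all $x,y\in E$. A pattern space is a non-empty set $\Omega$ of patterns $E\to A$ that contains every pattern $Q$ such that each patch $Q[x,U]$ ($x\in E$, $U$ compact) equals $R[y,U]$ for some $R\in\Omega$, $y\in E$. It is FLC if for each compact $U$ there are finitely many patterns $P_1,\dots,P_m$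 and compact sets $K_1,\dots,K_m\subset E$ such that for all $Q\in\Omega$ and $x\in E$ we have $Q[x,U]=P_i[y,U]$ for some $i$ and some $y\in K_i$. It is well-separated if there is a compact $V\subset E$ such that for all $P,Q\in\Omega$ with $P(0)\ne Q(0)$ there is a neighbourhood $N$ of $0$ with $P[b,V]\ne Q[b',V]$ for all $b,b'\in N$. Let $\Omega$ be an FLC, well-separated pattern space, and let $L$ be a linear automorphism of $E$ all of whose complex eigenvalues have modulus strictly larger than $1$. Suppose that $\Omega$ is $L$-sub, that is, equipped with a surjective map $S\colon L\Omega=\{LP : P\in\Omega\}\to\Omega$ for which there is $c\ge 0$ such that $P[x,c]=Q[y,c]$ implies $(SP)(x)=(SQ)(y)$, for all $P,Q\in L\Omega$ and $x,y\in E$. Let $\sigma=S\circ L\colon\Omega\to\Omega$, $\sigma(P)=S(LP)$. For $n \geq 1$, we say that $\sigma^n$ fixes LI-classes if $\sigma^n(P)$ and $P$ are in the same LI-class for each $P\in\Omega$. Then: 1. There is an integer $n\ge 1$ such that $\sigma^n$ fixes LI-classes. 2. Let $n\ge 1$ be any integer such that $\sigma^n$ fixes LI-classes, and let $P\in\Omega$.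 Then $P$ is $L^n$-sub, $\mathcal K_P$ is a closed subgroup of $E$, $L^n\mathcal K_P$ is a subgroup of finite index in $\mathcal K_P$, and the fibre $\sigma^{-n}(P)=\{Q\in\Omega : \sigma^n(Q)=P\}$ is finite with exactly $[L^n\mathcal K_P:\mathcal K_P]$ elements, where $[L^n\mathcal K_P:\mathcal K_P]$ denotes the index of $L^n\mathcal K_P$ in $\mathcal K_P$. Moreover, $\mathcal K_P$ has trivial discrete component (i.e. the quotient of $\mathcal K_P$ by its connected component containing $0$ is trivial) if and only if $\sigma^{-n}(P)$ is a singleton. 3. If $P\in\Omega$ is nonperiodic, then $\sigma^{-1}(P)$ is a singleton. -/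

import Mathlib

open scoped Topology

namespace EuclideanPattern

section Patterns

variable {E : Type*} [NormedAddCommGroup E] [NormedSpace ℝ E] {A B : Type*}

/-! A pattern on `E` with labels in `A` is an arbitrary function `E → A`. -/

/-- The patch `P[x, U]`: the function on `U` given by `u ↦ P (x + u)`. -/
def patch (P : E → A) (x : E) (U : Set E) : U → A := fun u => P (x + u)

/-- The translated pattern `P + z`. -/
def translatePattern (P : E → A) (z : E) : E → A := fun x => P (x - z)

/-- The inflated (distorted) pattern `L P`, determined by `(L P)[L x] = P[x]`. -/
def distort (L : E ≃ₗ[ℝ] E) (P : E → A) : E → A := fun x => P (L.symm x)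

/-- `Q` is locally indistinguishable from `P`: every patch of `Q` is a patch of `P`. -/
def LocallyIndistinguishable (Q P : E → A) : Prop :=
  ∀ U : Set E, IsCompact U → ∀ x : E, ∃ y : E, patch Q x U = patch P y U

/-- `P` and `Q` are locally isomorphic, that is, they have the same LI-class. -/
def LocallyIsomorphic (P Q : E → A) : Prop :=
  LocallyIndistinguishable P Q ∧ LocallyIndistinguishable Q P

/-- `Q` is locally derivable from `P` (the label types may differ). -/
def LocallyDerivable (P : E → A) (Q : E → B) : Prop :=
  ∃ c : ℝ, 0 ≤ c ∧ ∀ x y : E,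
    patch P x (Metric.closedBall 0 c) = patch P y (Metric.closedBall 0 c) → Q x = Q y

/-- The pattern `P` is `L`-substitutional: it has a predecessor `P'`. -/
def IsLSubPattern (L : E ≃ₗ[ℝ] E) (P : E → A) : Prop :=
  ∃ P' : E → A, LocallyIndistinguishable P' P ∧ LocallyDerivable (distort L P') P

/-- The group of translational periods of `P`. -/
def periods (P : E → A) : AddSubgroup E where
  carrier := {g | P = translatePattern P g}
  zero_mem' := by
    funext x
    simp [translatePattern]
  add_mem' := by
    intro a b ha hb
    have ha' : ∀ x, P x = P (x - a) := fun x => congrFun ha x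
    have hb' : ∀ x, P x = P (x - b) := fun x => congrFun hb x
    funext x
    show P x = P (x - (a + b))
    rw [ha' x, hb' (x - a), sub_sub]
  neg_mem' := by
    intro a ha
    have ha' : ∀ x, P x = P (x - a) := fun x => congrFun ha x
    funext x
    show P x = P (x - -a)
    rw [ha' (x - -a)]
    simp

/-- `P` is non-periodic if its only period is `0`. -/
def IsNonperiodic (P : E → A) : Prop := periods P = ⊥

/-- A subgroup `G` of `E` (closed, in all uses) has trivial discrete component if the quotient
of `G` by its identity component is trivial. -/
def HasTrivialDiscreteComponent (G : AddSubgroup E) : Prop :=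
  Subsingleton (G ⧸ AddSubgroup.connectedComponentOfZero G)

/-- The image `L G` of a subgroup `G` of `E` under a linear automorphism. -/
def imageSubgroup (L : E ≃ₗ[ℝ] E) (G : AddSubgroup E) : AddSubgroup E :=
  G.map (L : E →ₗ[ℝ] E).toAddMonoidHom

open scoped TensorProduct in
/-- All (complex) eigenvalues of `L` are strictly larger than `1` in modulus. -/
def IsExpansive (L : E ≃ₗ[ℝ] E) : Prop :=
  ∀ z : ℂ, Module.End.HasEigenvalue
    (LinearMap.baseChange ℂ (L : E →ₗ[ℝ] E) : Module.End ℂ (ℂ ⊗[ℝ] E)) z → 1 < ‖z‖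

end Patterns

section Spaces

variable {E : Type*} [NormedAddCommGroup E] [NormedSpace ℝ E] {A B : Type*}

/-- A (translational) pattern space: a non-empty set `Ω` of patterns that contains every pattern
all of whose patches occur in elements of `Ω`. -/
def IsPatternSpace (Ω : Set (E → A)) : Prop :=
  Ω.Nonempty ∧ ∀ Q : E → A,
    (∀ (x : E) (U : Set E), IsCompact U → ∃ R ∈ Ω, ∃ y : E, patch Q x U = patch R y U) → Q ∈ Ω

/-- Finite local complexity of a pattern space: for every compact `U`, all `U`-patches of elements
of `Ω` occur in one of finitely many patterns, with centres in given compact sets. -/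
def IsFLC (Ω : Set (E → A)) : Prop :=
  ∀ U : Set E, IsCompact U → ∃ (n : ℕ) (P : Fin n → E → A) (K : Fin n → Set E),
    (∀ i, IsCompact (K i)) ∧
      ∀ Q ∈ Ω, ∀ x : E, ∃ i, ∃ y ∈ K i, patch Q x U = patch (P i) y U

/-- A well-separated pattern space. -/
def IsWellSeparated (Ω : Set (E → A)) : Prop :=
  ∃ V : Set E, IsCompact V ∧ ∀ P ∈ Ω, ∀ Q ∈ Ω, P 0 ≠ Q 0 →
    ∃ N ∈ 𝓝 (0 : E), ∀ b ∈ N, ∀ b' ∈ N, patch P b V ≠ patch Q b' V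

/-- Local derivation maps between pattern spaces. -/
def IsLDMap {Ω : Set (E → A)} {Ω' : Set (E → B)} (f : Ω → Ω') : Prop :=
  ∃ c : ℝ, 0 ≤ c ∧ ∀ (P Q : Ω) (x y : E),
    patch (P : E → A) x (Metric.closedBall 0 c) = patch (Q : E → A) y (Metric.closedBall 0 c) →
      (f P : E → B) x = (f Q : E → B) y

/-- The inflated pattern space `L Ω = {L P | P ∈ Ω}`. -/
def inflate (L : E ≃ₗ[ℝ] E) (Ω : Set (E → A)) : Set (E → A) := distort L '' Ω

/-- The substitution `σ = S ∘ L : Ω → Ω` associated with a subdivision map `S : L Ω → Ω`. -/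
def substitution (L : E ≃ₗ[ℝ] E) {Ω : Set (E → A)} (S : inflate L Ω → Ω) : Ω → Ω :=
  fun P => S ⟨distort L P, Set.mem_image_of_mem _ P.2⟩

/-- A self-map of `Ω` fixes LI-classes if every element is locally isomorphic to its image. -/
def FixesLIClasses {Ω : Set (E → A)} (f : Ω → Ω) : Prop :=
  ∀ P : Ω, LocallyIsomorphic (f P : E → A) P

end Spaces

end EuclideanPattern

open EuclideanPattern

/-! The heart is recognizability modulo translation (`Propagates.exists_translation_of_apply_eq`):
predecessors of one pattern under an LI-class-fixing iterate are translates of each other. A large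
iterate has an inverse that contracts by 1/2, so a single radius `c` controls all its further powers
(`Propagates`). By FLC, patches fall into finitely many types up to a small translation, and
pigeonhole over types makes bounds uniform along infinite histories.

Let `Q`, `Q'` have the same image and follow histories of both. At each level they match near the
origin up to a small shift `ε m` (`Propagates.exists_matching`). Comparing adjacent levels, `L (ε
(m+1)) - ε m` gives a local period on a region that generates every patch of `Q'`
(`Propagates.exists_patchesCovered`), hence a genuine period (`Propagates.mem_periods_of_local`).
Thus the inflated shifts agree modulo periods, and on ever larger balls one fixed translation takes
`Q` to `Q'`.

Fibres are then torsors under `K / L K`, with `K` the closed group of periods (`encard_fibre`). The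
structure of closed subgroups makes this quotient finite, and trivial exactly when `K` is a linear
subspace. Part 1 holds because there are finitely many LI-classes
(`Propagates.exists_finite_invariant`), which the surjective substitution permutes. -/

namespace EuclideanPattern

/-! ### Local rules and their propagation along iterates -/

section LocalRules

variable {E : Type*} [NormedAddCommGroup E] {A : Type*}

theorem patch_eq_patch_iff {P Q : E → A} {x y : E} {U : Set E} :
    patch P x U = patch Q y U ↔ ∀ u ∈ U, P (x + u) = Q (y + u) := by
  refine ⟨fun h u hu => congrFun h ⟨u, hu⟩, fun h => funext fun u => h u u.2⟩

theorem patch_closedBall_eq_iff {P Q : E → A} {x y : E} {r : ℝ} :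
    patch P x (Metric.closedBall 0 r) = patch Q y (Metric.closedBall 0 r) ↔
      ∀ u : E, ‖u‖ ≤ r → P (x + u) = Q (y + u) := by
  simp [patch_eq_patch_iff]

theorem locallyIndistinguishable_of_forall_norm_le {P Q : E → A}
    (h : ∀ (r : ℝ) (x : E), ∃ y, ∀ u : E, ‖u‖ ≤ r → Q (x + u) = P (y + u)) :
    LocallyIndistinguishable Q P := by
  intro U hU x
  obtain ⟨r, hr⟩ := hU.isBounded.exists_norm_le
  obtain ⟨y, hy⟩ := h r x
  exact ⟨y, patch_eq_patch_iff.2 fun u hu => hy u (hr u hu)⟩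

theorem LocallyIndistinguishable.refl (P : E → A) : LocallyIndistinguishable P P :=
  fun _ _ x => ⟨x, rfl⟩

theorem LocallyIndistinguishable.trans {P Q R : E → A} (h : LocallyIndistinguishable P Q)
    (h' : LocallyIndistinguishable Q R) : LocallyIndistinguishable P R := by
  intro U hU x
  obtain ⟨y, hy⟩ := h U hU x
  obtain ⟨z, hz⟩ := h' U hU y
  exact ⟨z, hy.trans hz⟩

theorem mem_periods_iff {P : E → A} {g : E} : g ∈ periods P ↔ ∀ x, P (x + g) = P x := by
  constructor
  · intro h x
    have := congrFun (show P = translatePattern P g from h) (x + g)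
    simpa [translatePattern] using this
  · intro h
    show P = translatePattern P g
    funext x
    simpa [translatePattern] using h (x - g)

theorem LocallyIsomorphic.symm {P Q : E → A} (h : LocallyIsomorphic P Q) :
    LocallyIsomorphic Q P := ⟨h.2, h.1⟩

theorem LocallyIsomorphic.trans {P Q R : E → A} (h : LocallyIsomorphic P Q)
    (h' : LocallyIsomorphic Q R) : LocallyIsomorphic P R :=
  ⟨h.1.trans h'.1, h'.2.trans h.2⟩

variable [NormedSpace ℝ E]

theorem LocallyIndistinguishable.exists_forall_norm_le [FiniteDimensional ℝ E] {P Q : E → A}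
    (h : LocallyIndistinguishable Q P) (r : ℝ) (x : E) :
    ∃ y, ∀ u : E, ‖u‖ ≤ r → Q (x + u) = P (y + u) := by
  have : ProperSpace E := FiniteDimensional.proper ℝ E
  obtain ⟨y, hy⟩ := h _ (isCompact_closedBall 0 r) x
  exact ⟨y, patch_closedBall_eq_iff.1 hy⟩

theorem LocallyIndistinguishable.periods_le [FiniteDimensional ℝ E] {P Q : E → A}
    (h : LocallyIndistinguishable Q P) : periods P ≤ periods Q := by
  intro g hg
  rw [mem_periods_iff] at hg ⊢
  intro x
  obtain ⟨y, hy⟩ := h.exists_forall_norm_le ‖g‖ x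
  have h0 := hy 0 (by simp)
  rw [add_zero, add_zero] at h0
  rw [hy g le_rfl, hg, h0]

theorem LocallyIsomorphic.periods_eq [FiniteDimensional ℝ E] {P Q : E → A}
    (h : LocallyIsomorphic Q P) : periods Q = periods P :=
  le_antisymm h.2.periods_le h.1.periods_le

/-- The map `f` sends `P` to a pattern whose label at `L x` is determined by the patch of `P` of
radius `c` at `x`. -/
def HasLocalRule (L : E ≃ₗ[ℝ] E) {Ω : Set (E → A)} (c : ℝ) (f : Ω → Ω) : Prop :=
  ∀ (P Q : Ω) (x y : E), (∀ u : E, ‖u‖ ≤ c → (P : E → A) (x + u) = (Q : E → A) (y + u)) →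
    (f P : E → A) (L x) = (f Q : E → A) (L y)

variable {L : E ≃ₗ[ℝ] E} {Ω : Set (E → A)} {f : Ω → Ω} {c : ℝ}

theorem HasLocalRule.exists_iterate [FiniteDimensional ℝ E] (h : HasLocalRule L c f) (hc : 0 ≤ c)
    (k : ℕ) : ∃ c' : ℝ, 0 ≤ c' ∧ HasLocalRule (L ^ k) c' f^[k] := by
  induction k with
  | zero =>
    refine ⟨0, le_rfl, fun P Q x y H => ?_⟩
    simpa using H 0 (by simp)
  | succ k ih =>
    obtain ⟨c', hc', h'⟩ := ih
    let T : E →L[ℝ] E := LinearMap.toContinuousLinearMap ((L ^ k).symm : E →ₗ[ℝ] E)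
    refine ⟨c' + ‖T‖ * c, by positivity, fun P Q x y H => ?_⟩
    rw [Function.iterate_succ_apply', Function.iterate_succ_apply', pow_succ']
    refine h _ _ ((L ^ k) x) ((L ^ k) y) fun u hu => ?_
    have key := h' P Q (x + (L ^ k).symm u) (y + (L ^ k).symm u) fun w hw => by
      rw [add_assoc, add_assoc]
      refine H _ ?_
      have : ‖(L ^ k).symm u‖ ≤ ‖T‖ * c :=
        (T.le_opNorm u).trans (mul_le_mul_of_nonneg_left hu (norm_nonneg _))
      linarith [norm_add_le ((L ^ k).symm u) w]
    simpa using key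

theorem HasLocalRule.locallyIndistinguishable [FiniteDimensional ℝ E] (h : HasLocalRule L c f)
    {P Q : Ω} (hPQ : LocallyIndistinguishable (P : E → A) Q) :
    LocallyIndistinguishable (f P : E → A) (f Q) := by
  refine locallyIndistinguishable_of_forall_norm_le fun r x => ?_
  let T : E →L[ℝ] E := LinearMap.toContinuousLinearMap (L.symm : E →ₗ[ℝ] E)
  obtain ⟨y, hy⟩ := hPQ.exists_forall_norm_le (‖T‖ * r + c) (L.symm x)
  refine ⟨L y, fun u hu => ?_⟩
  have key := h P Q (L.symm x + L.symm u) (y + L.symm u) fun w hw => by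
    rw [add_assoc, add_assoc]
    refine hy _ ?_
    have : ‖L.symm u‖ ≤ ‖T‖ * r :=
      (T.le_opNorm u).trans (mul_le_mul_of_nonneg_left hu (norm_nonneg _))
    linarith [norm_add_le (L.symm u) w]
  simpa using key

/-- Translation equivariance: shifting a pattern by `g` shifts its image by `L g`. -/
theorem HasLocalRule.map_apply_of_shift (h : HasLocalRule L c f) {P Q : Ω} {g : E}
    (hPQ : ∀ x, (P : E → A) x = (Q : E → A) (x + g)) (x : E) :
    (f P : E → A) x = (f Q : E → A) (x + L g) := by
  have key := h P Q (L.symm x) (L.symm x + g) fun u _ => by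
    rw [hPQ, add_right_comm]
  simpa using key

/-- Agreement of patches of radius `c` propagates to agreement of the images, with the same
radius; this property is inherited by iterates. -/
def Propagates (L : E ≃ₗ[ℝ] E) {Ω : Set (E → A)} (c : ℝ) (f : Ω → Ω) : Prop :=
  ∀ (P Q : Ω) (x y : E), (∀ u : E, ‖u‖ ≤ c → (P : E → A) (x + u) = (Q : E → A) (y + u)) →
    ∀ w : E, ‖w‖ ≤ c → (f P : E → A) (L x + w) = (f Q : E → A) (L y + w)

/-- For `‖w‖ ≤ 2c` the contraction gives `‖L⁻¹ w‖ ≤ c`, so the ball of radius `c` about `x + L⁻¹ w`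
stays within radius `2c` of `x`. Unlike the radii of `HasLocalRule.exists_iterate`, this one is the
same for all iterates. -/
theorem HasLocalRule.propagates (h : HasLocalRule L c f)
    (hL : ∀ x, ‖L.symm x‖ ≤ ‖x‖ / 2) : Propagates L (2 * c) f := by
  intro P Q x y H w hw
  have key := h P Q (x + L.symm w) (y + L.symm w) fun u hu => by
    rw [add_assoc, add_assoc]
    refine H _ ?_
    linarith [norm_add_le (L.symm w) u, hL w]
  simpa using key

theorem Propagates.iterate (h : Propagates L c f) (k : ℕ) : Propagates (L ^ k) c f^[k] := by
  induction k with
  | zero => intro P Q x y H w hw; simpa using H w hw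
  | succ k ih =>
    intro P Q x y H w hw
    rw [Function.iterate_succ_apply', Function.iterate_succ_apply', pow_succ']
    exact h _ _ _ _ (ih P Q x y H) w hw

theorem Propagates.apply (h : Propagates L c f) (hc : 0 ≤ c) (k : ℕ) (P Q : Ω) (x y : E)
    (H : ∀ u : E, ‖u‖ ≤ c → (P : E → A) (x + u) = (Q : E → A) (y + u)) :
    (f^[k] P : E → A) ((L ^ k) x) = (f^[k] Q : E → A) ((L ^ k) y) := by
  simpa using h.iterate k P Q x y H 0 (by simpa)

/-- Agreement on a large ball propagates to agreement of the images on the inflated ball. -/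
theorem Propagates.apply_add (h : Propagates L c f) (hc : 0 ≤ c) (k : ℕ) {P Q : Ω} {x y : E}
    {r : ℝ} (H : ∀ u : E, ‖u‖ ≤ r + c → (P : E → A) (x + u) = (Q : E → A) (y + u)) {u : E}
    (hu : ‖u‖ ≤ r) :
    (f^[k] P : E → A) ((L ^ k) (x + u)) = (f^[k] Q : E → A) ((L ^ k) (y + u)) := by
  refine h.apply hc k P Q _ _ fun w hw => ?_
  rw [add_assoc, add_assoc]
  exact H _ ((norm_add_le u w).trans (add_le_add hu hw))

theorem norm_pow_symm_le (hL : ∀ x, ‖L.symm x‖ ≤ ‖x‖ / 2) (k : ℕ) (x : E) :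
    ‖(L ^ k).symm x‖ ≤ ‖x‖ / 2 ^ k := by
  induction k generalizing x with
  | zero => simpa using le_of_eq (by rfl)
  | succ k ih =>
    have : (L ^ (k + 1)).symm x = (L ^ k).symm (L.symm x) := by
      rw [pow_succ']; rfl
    rw [this, pow_succ]
    refine (ih _).trans ?_
    rw [div_le_div_iff₀ (by positivity) (by positivity)]
    have := hL x
    have h2 : (0 : ℝ) < 2 ^ k := by positivity
    nlinarith

theorem exists_norm_pow_symm_le (hL : ∀ x, ‖L.symm x‖ ≤ ‖x‖ / 2) (r : ℝ) :
    ∃ m₀ : ℕ, ∀ m ≥ m₀, ∀ x : E, ‖x‖ ≤ r → ‖(L ^ m).symm x‖ ≤ 1 := by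
  obtain ⟨m₀, hm₀⟩ := pow_unbounded_of_one_lt r (one_lt_two)
  refine ⟨m₀, fun m hm x hx => (norm_pow_symm_le hL m x).trans ?_⟩
  rw [div_le_one (by positivity)]
  exact hx.trans (hm₀.le.trans (pow_le_pow_right₀ one_le_two hm))

end LocalRules

/-! ### Finitely many patch types, and histories of a surjection -/

section Types

variable {E : Type*} [NormedAddCommGroup E] [NormedSpace ℝ E] {A : Type*}

/-- Patches of a given radius in an FLC space fall into finitely many types, such that patches of
the same type agree up to a small translation. -/
theorem IsFLC.exists_types [FiniteDimensional ℝ E] {Ω : Set (E → A)} (hFLC : IsFLC Ω) (r : ℝ)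
    {δ : ℝ} (hδ : 0 < δ) :
    ∃ (M : ℕ) (τ : Ω → E → Fin M), ∀ (P Q : Ω) (x y : E), τ P x = τ Q y →
      ∃ θ : E, ‖θ‖ ≤ δ ∧ ∀ u : E, ‖u‖ ≤ r →
        (P : E → A) (x + u) = (Q : E → A) (y + (θ + u)) := by
  have : ProperSpace E := FiniteDimensional.proper ℝ E
  obtain ⟨n, F, K, hK, hF⟩ := hFLC _ (isCompact_closedBall (0 : E) (r + δ))
  -- A type is the index of a model pattern together with a `δ / 2`-ball containing the centre used
  -- there; centres in one ball differ by at most `δ`.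
  choose t htK htf ht using fun i => (hK i).finite_cover_balls (half_pos hδ)
  have hfin : Finite (Σ i : Fin n, t i) :=
    have := fun i => (htf i).to_subtype
    inferInstance
  have key : ∀ (P : Ω) (x : E), ∃ s : Σ i : Fin n, t i, ∃ y : E, ‖y - s.2‖ ≤ δ / 2 ∧
      ∀ u : E, ‖u‖ ≤ r + δ → (P : E → A) (x + u) = F s.1 (y + u) := by
    intro P x
    obtain ⟨i, y, hy, h⟩ := hF P P.2 x
    obtain ⟨z, hz, hyz⟩ := Set.mem_iUnion₂.1 (ht i hy)
    refine ⟨⟨i, z, hz⟩, y, ?_, patch_closedBall_eq_iff.1 h⟩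
    rw [← dist_eq_norm]
    exact (Metric.mem_ball.1 hyz).le
  choose s y hy hs using key
  obtain ⟨M, ⟨e⟩⟩ := Finite.exists_equiv_fin (Σ i : Fin n, t i)
  refine ⟨M, fun P x => e (s P x), fun P Q x x' h => ?_⟩
  have h' : s P x = s Q x' := e.injective h
  have hy' := hy Q x'
  have hs' := hs Q x'
  rw [← h'] at hy' hs'
  have hθ : ‖y P x - y Q x'‖ ≤ δ := by
    have := norm_sub_le (y P x - (s P x).2) (y Q x' - (s P x).2)
    rw [sub_sub_sub_cancel_right] at this
    linarith [hy P x]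
  refine ⟨y P x - y Q x', hθ, fun u hu => ?_⟩
  rw [hs P x u (by linarith), hs' _ (by linarith [norm_add_le (y P x - y Q x') u])]
  congr 1
  abel

end Types

section History

variable {α : Type*} {f : α → α}

theorem exists_history (hf : Function.Surjective f) (Q : α) :
    ∃ H : ℕ → α, H 0 = Q ∧ ∀ k m, f^[k] (H (k + m)) = H m := by
  refine ⟨fun m => (Function.surjInv hf)^[m] Q, rfl, fun k m => ?_⟩
  show f^[k] ((Function.surjInv hf)^[k + m] Q) = _
  rw [Function.iterate_add_apply]
  exact (Function.rightInverse_surjInv hf).iterate k _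

end History

end EuclideanPattern

namespace EuclideanPattern

/-! ### Recognizability modulo translations -/

section Uniformity

theorem exists_uniform_bound {ι : Type*} [Finite ι] (p : ι → ℕ → Prop) :
    ∃ J : ℕ, ∀ i, (∃ j, p i j) → ∃ j ≤ J, p i j := by
  classical
  have h : ∀ i, ∃ j₀, (∃ j, p i j) → p i j₀ := fun i => by
    by_cases hi : ∃ j, p i j
    · exact ⟨hi.choose, fun _ => hi.choose_spec⟩
    · exact ⟨0, fun h => absurd h hi⟩
  choose j₀ hj₀ using h
  obtain ⟨J, hJ⟩ := (Set.finite_range j₀).bddAbove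
  exact ⟨J, fun i hi => ⟨j₀ i, hJ ⟨i, rfl⟩, hj₀ i hi⟩⟩

end Uniformity

section Recognizability

variable {E : Type*} [NormedAddCommGroup E] {A : Type*} {Ω : Set (E → A)} {f : Ω → Ω}

theorem FixesLIClasses.iterate (h : FixesLIClasses f) (k : ℕ) : FixesLIClasses f^[k] := by
  induction k with
  | zero => exact fun P => ⟨.refl _, .refl _⟩
  | succ k ih =>
    intro P
    rw [Function.iterate_succ_apply']
    exact (h _).trans (ih P)

variable [NormedSpace ℝ E] {L : E ≃ₗ[ℝ] E} {c : ℝ}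

/-- Every patch of `P` of radius `s` occurs in `f^[j] Z`, on the inflated ball of radius `r`. -/
def PatchesCovered (L : E ≃ₗ[ℝ] E) (f : Ω → Ω) (s : ℝ) (P Z : Ω) (j : ℕ) (r : ℝ) : Prop :=
  ∀ x : E, ∃ y : E, ‖y‖ ≤ r ∧ ∀ w : E, ‖w‖ ≤ s →
    (P : E → A) (x + w) = (f^[j] Z : E → A) ((L ^ j) y + w)

/-- A local period on a region that generates all patches is a period. -/
theorem Propagates.mem_periods_of_local (hp : Propagates L c f) (hc : 0 ≤ c) {P Z : Ω}
    {j k : ℕ} (hjk : j ≤ k) {r : ℝ} (hcov : PatchesCovered L f (c + 1) P Z j r) {d : E}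
    (hd : ‖(L ^ j) d‖ ≤ 1)
    (hloc : ∀ u : E, ‖u‖ ≤ r →
      (f^[k] Z : E → A) ((L ^ k) (u + d)) = (f^[k] Z : E → A) ((L ^ k) u)) :
    (L ^ k) d ∈ periods (f^[k - j] P : E → A) := by
  obtain ⟨i, rfl⟩ := Nat.exists_eq_add_of_le' hjk
  rw [Nat.add_sub_cancel, mem_periods_iff]
  intro X
  obtain ⟨y, hy, h⟩ := hcov ((L ^ i).symm X)
  -- Of the covered radius `c + 1`, `c` is spent on the local rule; the remaining 1 leaves room for
  -- the offset `(L ^ j) d`.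
  have key : ∀ w : E, ‖w‖ ≤ 1 → (f^[i] P : E → A) (X + (L ^ i) w) =
      (f^[i + j] Z : E → A) ((L ^ (i + j)) y + (L ^ i) w) := by
    intro w hw
    have := hp.apply hc i P (f^[j] Z) ((L ^ i).symm X + w) ((L ^ j) y + w) fun u hu => by
      rw [add_assoc, add_assoc]
      exact h _ (by linarith [norm_add_le w u])
    rw [Function.iterate_add_apply, pow_add]
    simpa using this
  have h0 := key 0 (by simp)
  have h1 := key _ hd
  rw [map_zero, add_zero, add_zero] at h0
  have e : (L ^ i) ((L ^ j) d) = (L ^ (i + j)) d := by rw [pow_add]; rfl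
  rw [e, ← map_add] at h1
  rw [h1, h0, hloc y hy]

variable [FiniteDimensional ℝ E]

/-- The same `θ` serves every `k`: equality of types compares all futures at once. -/
theorem Propagates.exists_types (hp : Propagates L c f) (hc : 0 ≤ c) (hFLC : IsFLC Ω) (r : ℝ)
    {δ : ℝ} (hδ : 0 < δ) :
    ∃ (M : ℕ) (τ : Ω → E → Fin M), ∀ (P Q : Ω) (x y : E), τ P x = τ Q y →
      ∃ θ : E, ‖θ‖ ≤ δ ∧ ∀ (k : ℕ) (u : E), ‖u‖ ≤ r →
        (f^[k] P : E → A) ((L ^ k) (x + u)) = (f^[k] Q : E → A) ((L ^ k) (y + (θ + u))) := by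
  obtain ⟨M, τ, hτ⟩ := hFLC.exists_types (r + c) hδ
  refine ⟨M, τ, fun P Q x y h => ?_⟩
  obtain ⟨θ, hθ, H⟩ := hτ P Q x y h
  refine ⟨θ, hθ, fun k u hu => ?_⟩
  rw [← add_assoc]
  refine hp.apply_add hc k (fun v hv => ?_) hu
  rw [add_assoc]
  exact H v hv

/-- Two patterns that are merged by some iterate of `f` agree, near the origin and on a uniformly
large scale, up to a translation that is small on that scale. -/
theorem Propagates.exists_matching (hp : Propagates L c f) (hc : 0 ≤ c) (hFLC : IsFLC Ω)
    (hf : Function.Surjective f) (r : ℝ) {δ : ℝ} (hδ : 0 < δ) (k₁ : ℕ) :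
    ∃ k₀ ≥ k₁, ∀ (Q Q' : Ω) (m : ℕ), f^[m] Q = f^[m] Q' →
      ∃ ε : E, ‖ε‖ ≤ 2 * δ ∧ ∀ u : E, ‖u‖ ≤ r →
        (Q : E → A) ((L ^ k₀) u) = (Q' : E → A) ((L ^ k₀) (u + ε)) := by
  obtain ⟨M, τ, hτ⟩ := hp.exists_types hc hFLC (r + 2 * δ) hδ
  -- A pair of types has the property at `k` if some patterns of these types merge within `k` steps.
  -- There are finitely many pairs, so one `J` bounds the first merging time, independently of `m`.
  let p : Fin M × Fin M → ℕ → Prop := fun s k =>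
    ∃ W W' : Ω, τ W 0 = s.1 ∧ τ W' 0 = s.2 ∧ f^[k] W = f^[k] W'
  have hmono : ∀ s k l, k ≤ l → p s k → p s l := by
    rintro s k l hkl ⟨W, W', h, h', e⟩
    refine ⟨W, W', h, h', ?_⟩
    obtain ⟨j, rfl⟩ := Nat.exists_eq_add_of_le' hkl
    rw [Function.iterate_add_apply, e, ← Function.iterate_add_apply]
  obtain ⟨J, hJ⟩ := exists_uniform_bound p
  refine ⟨max k₁ J, le_max_left _ _, fun Q Q' m hQ => ?_⟩
  set k₀ := max k₁ J
  obtain ⟨Z, hZ⟩ := hf.iterate k₀ Q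
  obtain ⟨Z', hZ'⟩ := hf.iterate k₀ Q'
  have hex : p (τ Z 0, τ Z' 0) (m + k₀) :=
    ⟨Z, Z', rfl, rfl, by rw [Function.iterate_add_apply, Function.iterate_add_apply, hZ, hZ', hQ]⟩
  obtain ⟨j, hj, hpj⟩ := hJ _ ⟨_, hex⟩
  -- The remote predecessors `Z`, `Z'` may merge late, but `W`, `W'` of the same types have already
  -- merged after `k₀` steps, and their common image is compared with `Q` and `Q'`.
  obtain ⟨W, W', hW, hW', e⟩ := hmono _ _ k₀ (hj.trans (le_max_right _ _)) hpj
  obtain ⟨θ, hθ, H⟩ := hτ Z W 0 0 hW.symm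
  obtain ⟨θ', hθ', H'⟩ := hτ Z' W' 0 0 hW'.symm
  have hε : ‖θ - θ'‖ ≤ 2 * δ := by linarith [norm_sub_le θ θ']
  refine ⟨θ - θ', hε, fun u hu => ?_⟩
  have h1 := H k₀ u (by linarith)
  have h2 := H' k₀ (u + (θ - θ')) (by linarith [norm_add_le u (θ - θ')])
  rw [hZ, zero_add, zero_add] at h1
  rw [hZ', zero_add, zero_add] at h2
  rw [h1, h2, e, show θ' + (u + (θ - θ')) = θ + u by abel]

/-- One occurrence in `Q` is chosen per type; finitely many choices give a bounded radius. -/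
theorem IsFLC.exists_radius (hFLC : IsFLC Ω) (s : ℝ) (P : Ω) {Q : E → A}
    (h : LocallyIndistinguishable (P : E → A) Q) :
    ∃ ρ : ℝ, ∀ x : E, ∃ y : E, ‖y‖ ≤ ρ ∧ ∀ w : E, ‖w‖ ≤ s → (P : E → A) (x + w) = Q (y + w) := by
  obtain ⟨M, τ, hτ⟩ := hFLC.exists_types s one_pos
  have hrep : ∀ i : Fin M, ∃ y : E, ∀ x, τ P x = i → ∃ θ : E, ‖θ‖ ≤ 1 ∧ ∀ w : E, ‖w‖ ≤ s →
      (P : E → A) (x + w) = Q (y + (θ + w)) := by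
    intro i
    by_cases hi : ∃ x₀, τ P x₀ = i
    · obtain ⟨x₀, rfl⟩ := hi
      obtain ⟨y, hy⟩ := h.exists_forall_norm_le (1 + s) x₀
      refine ⟨y, fun x hx => ?_⟩
      obtain ⟨θ, hθ, H⟩ := hτ P P x x₀ hx
      exact ⟨θ, hθ, fun w hw => (H w hw).trans (hy _ (by linarith [norm_add_le θ w]))⟩
    · exact ⟨0, fun x hx => absurd ⟨x, hx⟩ hi⟩
  choose y hy using hrep
  obtain ⟨ρ, hρ⟩ := (Set.finite_range fun i => ‖y i‖).bddAbove
  refine ⟨ρ + 1, fun x => ?_⟩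
  obtain ⟨θ, hθ, H⟩ := hy _ x rfl
  refine ⟨y (τ P x) + θ, ?_, fun w hw => ?_⟩
  · have : ‖y (τ P x)‖ ≤ ρ := hρ ⟨_, rfl⟩
    linarith [norm_add_le (y (τ P x)) θ]
  · rw [add_assoc]
    exact H w hw

/-- All sufficiently remote predecessors generate, near the origin and in a uniformly bounded
number of steps, all patches of `P`. -/
theorem Propagates.exists_patchesCovered (hp : Propagates L c f) (hc : 0 ≤ c) (hFLC : IsFLC Ω)
    (hL : ∀ x, ‖L.symm x‖ ≤ ‖x‖ / 2) (s : ℝ) (P : Ω) :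
    ∃ J : ℕ, ∀ H : ℕ → Ω, (∀ k m, f^[k] (H (k + m)) = H m) →
      LocallyIndistinguishable (P : E → A) (H 0) →
        ∃ m₀, ∀ m ≥ m₀, ∃ j ≤ J, PatchesCovered L f s P (H m) j 2 := by
  obtain ⟨M, τ, hτ⟩ := hp.exists_types hc hFLC (1 + s) one_pos
  obtain ⟨J, hJ⟩ := exists_uniform_bound fun (i : Fin M) j =>
    ∃ Z : Ω, τ Z 0 = i ∧ PatchesCovered L f s P Z j 1
  refine ⟨J, fun H hH hPH => ?_⟩
  obtain ⟨ρ, hρ⟩ := hFLC.exists_radius s P hPH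
  obtain ⟨m₀, hm₀⟩ := exists_norm_pow_symm_le hL ρ
  refine ⟨m₀, fun m hm => ?_⟩
  have hcov : PatchesCovered L f s P (H m) m 1 := by
    intro x
    obtain ⟨y, hy, h⟩ := hρ x
    refine ⟨(L ^ m).symm y, hm₀ m hm y hy, fun w hw => ?_⟩
    rw [LinearEquiv.apply_symm_apply, show f^[m] (H m) = H 0 from hH m 0]
    exact h w hw
  -- Covering depends only on the type at the origin, so `H m` may be replaced by a `Z` that covers
  -- within `J` steps. Returning to `H m` costs a shift of norm at most 1, which turns radius 1 into
  -- 2.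
  obtain ⟨j, hj, Z, hZ, hcovZ⟩ := hJ _ ⟨m, H m, rfl, hcov⟩
  refine ⟨j, hj, fun x => ?_⟩
  obtain ⟨θ, hθ, hθ'⟩ := hτ Z (H m) 0 0 hZ
  obtain ⟨y, hy, h⟩ := hcovZ x
  refine ⟨θ + y, by linarith [norm_add_le θ y], fun w hw => ?_⟩
  have hw' : ‖(L ^ j).symm w‖ ≤ ‖w‖ :=
    (norm_pow_symm_le hL j w).trans (div_le_self (norm_nonneg _) (one_le_pow₀ one_le_two))
  have key := hθ' j (y + (L ^ j).symm w) (by linarith [norm_add_le y ((L ^ j).symm w)])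
  rw [h w hw]
  simpa [add_assoc] using key

theorem exists_pow_bound (L : E ≃ₗ[ℝ] E) (J : ℕ) :
    ∃ B : ℝ, 1 ≤ B ∧ ∀ j ≤ J, ∀ x : E, ‖(L ^ j) x‖ ≤ B * ‖x‖ := by
  let T : ℕ → E →L[ℝ] E := fun j => LinearMap.toContinuousLinearMap ((L ^ j : E ≃ₗ[ℝ] E) : E →ₗ[ℝ] E)
  obtain ⟨B, hB⟩ := ((Finset.range (J + 1)).image fun j => ‖T j‖).bddAbove
  refine ⟨max 1 B, le_max_left _ _, fun j hj x => ((T j).le_opNorm x).trans ?_⟩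
  have : ‖T j‖ ≤ B := hB (by simpa using ⟨j, by omega, rfl⟩)
  exact mul_le_mul_of_nonneg_right (this.trans (le_max_right _ _)) (norm_nonneg _)

/-- **Recognizability modulo translations.** A surjective substitution that fixes LI-classes is
injective up to translation. -/
theorem Propagates.exists_translation_of_apply_eq (hp : Propagates L c f) (hc : 0 ≤ c)
    (hFLC : IsFLC Ω) (hL : ∀ x, ‖L.symm x‖ ≤ ‖x‖ / 2) (hf : Function.Surjective f)
    (hfix : FixesLIClasses f) {Q Q' : Ω} (hQ : f Q = f Q') :
    ∃ h : E, ∀ x, (Q : E → A) x = (Q' : E → A) (x + h) := by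
  obtain ⟨H, hH0, hH⟩ := exists_history hf Q
  obtain ⟨H', hH0', hH'⟩ := exists_history hf Q'
  obtain ⟨J, hJ⟩ := hp.exists_patchesCovered hc hFLC hL (c + 1) Q'
  obtain ⟨m₀, hm₀⟩ := hJ H' hH' (hH0' ▸ .refl _)
  -- The power `J + 1` occurs because `(L ^ j) (L (ε (m + 1)))` must be bounded for `j ≤ J`. With `δ
  -- = 1 / (4B)` both terms of `(L ^ j) d` are at most 1/2.
  obtain ⟨B, hB1, hB⟩ := exists_pow_bound L (J + 1)
  have hB0 : 0 < B := by linarith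
  have hδ : 0 < 1 / (4 * B) := by positivity
  have hδB : B * (2 * (1 / (4 * B))) = 1 / 2 := by field_simp; norm_num
  -- The 3 is the covering radius 2 plus `‖ε m‖ ≤ 1`; the extra `c` lets the match be pushed
  -- forward.
  obtain ⟨k, hkJ, hk⟩ := hp.exists_matching hc hFLC hf (3 + c) hδ J
  have hmerge : ∀ m, f^[m + 1] (H m) = f^[m + 1] (H' m) := fun m => by
    rw [Function.iterate_succ_apply', Function.iterate_succ_apply',
      show f^[m] (H m) = H 0 from hH m 0, show f^[m] (H' m) = H' 0 from hH' m 0, hH0, hH0', hQ]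
  choose ε hε hmatch using fun m => hk (H m) (H' m) (m + 1) (hmerge m)
  have hpow : ∀ (i j : ℕ) (x : E), (L ^ i) ((L ^ j) x) = (L ^ (i + j)) x := fun i j x => by
    rw [pow_add]; rfl
  have htrans : ∀ i m u, ‖u‖ ≤ 3 → (H m : E → A) ((L ^ i) ((L ^ k) u)) =
      (H' m : E → A) ((L ^ i) ((L ^ k) (u + ε (i + m)))) := by
    intro i m u hu
    rw [← hH i m, ← hH' i m]
    refine hp.apply hc i _ _ _ _ fun w hw => ?_
    have hw' : ‖(L ^ k).symm w‖ ≤ c :=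
      (norm_pow_symm_le hL k w).trans
        ((div_le_self (norm_nonneg _) (one_le_pow₀ one_le_two)).trans hw)
    have := hmatch (i + m) (u + (L ^ k).symm w) (by linarith [norm_add_le u ((L ^ k).symm w)])
    rw [add_right_comm] at this
    simpa using this
  have hper : ∀ m, periods (f^[m] Q' : E → A) = periods (Q' : E → A) := fun m =>
    (hfix.iterate m Q').periods_eq
  have hLK : ∀ g ∈ periods (Q' : E → A), L g ∈ periods (Q' : E → A) := by
    intro g hg
    rw [← hper 1, mem_periods_iff]
    rw [mem_periods_iff] at hg
    intro x
    have := hp (Q') Q' (L.symm x) (L.symm x + g) (fun u _ => by rw [add_right_comm, hg]) 0 (by simpa)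
    simpa using this.symm
  have hLK' : ∀ i, ∀ g ∈ periods (Q' : E → A), (L ^ i) g ∈ periods (Q' : E → A) := by
    intro i
    induction i with
    | zero => exact fun g hg => hg
    | succ i ih =>
      intro g hg
      rw [pow_succ']
      exact hLK _ (ih g hg)
  -- Level `m` matches by `ε m`, and the image of the match at level `m + 1` gives another by `L (ε
  -- (m + 1))`. Their difference is a local period of `H' m`, and the region where it holds
  -- generates all patches of `Q'`.
  have hd : ∀ m ≥ m₀, (L ^ k) (L (ε (m + 1)) - ε m) ∈ periods (Q' : E → A) := by
    intro m hm
    obtain ⟨j, hj, hcov⟩ := hm₀ (k + m) (by omega)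
    rw [← hper (k - j)]
    refine hp.mem_periods_of_local hc (hj.trans hkJ) hcov ?_ fun u hu => ?_
    · have h1 : ‖(L ^ j) (L (ε (m + 1)))‖ ≤ 1 / 2 := by
        have e : (L ^ j) (L (ε (m + 1))) = (L ^ (j + 1)) (ε (m + 1)) := by rw [pow_succ]; rfl
        rw [e, ← hδB]
        exact (hB _ (by omega) _).trans (mul_le_mul_of_nonneg_left (hε _) hB0.le)
      have h2 : ‖(L ^ j) (ε m)‖ ≤ 1 / 2 := by
        rw [← hδB]
        exact (hB _ (by omega) _).trans (mul_le_mul_of_nonneg_left (hε _) hB0.le)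
      rw [map_sub]
      linarith [norm_sub_le ((L ^ j) (L (ε (m + 1)))) ((L ^ j) (ε m))]
    · rw [hH' k m]
      have hεm : ‖ε m‖ ≤ 1 := by
        refine (hε m).trans (le_trans ?_ (hδB.le.trans (by norm_num)))
        exact le_mul_of_one_le_left (by positivity) hB1
      have hv : ‖u - ε m‖ ≤ 3 := by linarith [norm_sub_le u (ε m)]
      have h1 := htrans 0 m (u - ε m) hv
      have h2 := htrans 1 m (L.symm (u - ε m))
        ((hL _).trans (by linarith [norm_nonneg (u - ε m)]))
      rw [hpow, hpow, add_comm 1 k, ← hpow, ← hpow, pow_one, map_add, LinearEquiv.apply_symm_apply,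
        add_comm 1 m] at h2
      simp only [pow_zero, zero_add, sub_add_cancel] at h1
      have h1' : (H m : E → A) ((L ^ k) (u - ε m)) = (H' m : E → A) ((L ^ k) u) := h1
      rw [← h1', h2, show u - ε m + L (ε (m + 1)) = u + (L (ε (m + 1)) - ε m) by abel]
  -- Telescoping: the periods are `L`-invariant, so the shifts seen at level 0 are constant modulo
  -- periods.
  have he : ∀ n, (L ^ (m₀ + n)) ((L ^ k) (ε (m₀ + n))) - (L ^ m₀) ((L ^ k) (ε m₀)) ∈
      periods (Q' : E → A) := by
    intro n
    induction n with
    | zero => simp [zero_mem]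
    | succ n ih =>
      have h1 := hLK' (m₀ + n) _ (hd (m₀ + n) (by omega))
      have h2 := add_mem h1 ih
      convert h2 using 1
      have e : ∀ x, (L ^ k) (L x) = L ((L ^ k) x) := fun x => by
        have h := hpow 1 k x
        rw [add_comm, ← hpow, pow_one] at h
        exact h.symm
      rw [map_sub, map_sub, e, ← add_assoc, pow_succ, LinearEquiv.mul_apply]
      abel
  refine ⟨(L ^ m₀) ((L ^ k) (ε m₀)), fun X => ?_⟩
  obtain ⟨n₀, hn₀⟩ := exists_norm_pow_symm_le hL ‖X‖
  have h1 := htrans (m₀ + n₀) 0 ((L ^ (m₀ + n₀ + k)).symm X)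
    ((hn₀ _ (by omega) X le_rfl).trans (by norm_num))
  rw [hH0, hH0', map_add, map_add, hpow, hpow, LinearEquiv.apply_symm_apply, add_zero] at h1
  have h2 := mem_periods_iff.1 (he n₀) (X + (L ^ m₀) ((L ^ k) (ε m₀)))
  rw [h1, ← h2, ← hpow, add_assoc, add_sub_cancel]

end Recognizability

end EuclideanPattern

namespace EuclideanPattern

/-! ### Closed subgroups of `E` invariant under a linear automorphism -/

section ClosedSubgroups

open Filter

variable {E : Type*} [NormedAddCommGroup E] [NormedSpace ℝ E]

/-- The largest linear subspace contained in an additive subgroup. -/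
def lineality (K : AddSubgroup E) : Submodule ℝ E where
  carrier := {v | ∀ t : ℝ, t • v ∈ K}
  zero_mem' t := by rw [smul_zero]; exact K.zero_mem
  add_mem' ha hb t := by rw [smul_add]; exact K.add_mem (ha t) (hb t)
  smul_mem' c v hv t := by rw [smul_smul]; exact hv _

theorem mem_of_mem_lineality {K : AddSubgroup E} {v : E} (h : v ∈ lineality K) : v ∈ K := by
  simpa using h 1

theorem mem_imageSubgroup {L : E ≃ₗ[ℝ] E} {K : AddSubgroup E} {x : E} :
    x ∈ imageSubgroup L K ↔ ∃ g ∈ K, L g = x := Iff.rfl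

theorem mem_imageSubgroup_iff_symm {L : E ≃ₗ[ℝ] E} {K : AddSubgroup E} {x : E} :
    x ∈ imageSubgroup L K ↔ L.symm x ∈ K := by
  rw [mem_imageSubgroup]
  constructor
  · rintro ⟨g, hg, rfl⟩
    simpa using hg
  · exact fun h => ⟨_, h, by simp⟩

/-- Limits of directions of short elements of a closed subgroup span lines in the subgroup. -/
theorem tendsto_smul_mem_of_tendsto_zero {K : AddSubgroup E} (hK : IsClosed (K : Set E))
    {p : ℕ → E} {w : E} (hpK : ∀ n, p n ∈ K) (hp : Tendsto p atTop (𝓝 0))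
    (hw : Tendsto (fun n => ‖p n‖⁻¹ • p n) atTop (𝓝 w)) : w ∈ lineality K := by
  intro t
  -- Rounding to an integer multiple stays in `K` and moves the point by at most `‖p n‖`.
  have hlim : Tendsto (fun n => ⌊t * ‖p n‖⁻¹⌋ • p n) atTop (𝓝 (t • w)) := by
    have h1 : Tendsto (fun n => t • (‖p n‖⁻¹ • p n)) atTop (𝓝 (t • w)) := hw.const_smul t
    have h2 : Tendsto (fun n => Int.fract (t * ‖p n‖⁻¹) • p n) atTop (𝓝 0) := by
      refine squeeze_zero_norm (fun n => ?_) (tendsto_norm_zero.comp hp)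
      rw [norm_smul, Real.norm_of_nonneg (Int.fract_nonneg _)]
      exact mul_le_of_le_one_left (norm_nonneg _) (Int.fract_lt_one _).le
    have h3 := h1.sub h2
    rw [sub_zero] at h3
    refine h3.congr fun n => ?_
    rw [smul_smul, ← sub_smul, Int.self_sub_fract, Int.cast_smul_eq_zsmul]
  exact hK.mem_of_tendsto hlim (Eventually.of_forall fun n => K.zsmul_mem (hpK n) _)

variable [FiniteDimensional ℝ E]

/-- Short elements of a closed subgroup lie in its lineality space. -/
theorem exists_forall_norm_lt_mem_lineality {K : AddSubgroup E} (hK : IsClosed (K : Set E)) :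
    ∃ ρ > 0, ∀ g ∈ K, ‖g‖ < ρ → g ∈ lineality K := by
  have : ProperSpace E := FiniteDimensional.proper ℝ E
  by_contra! hcon
  obtain ⟨V', hV'⟩ := (lineality K).exists_isCompl
  choose g hgK hg hgV using fun n : ℕ => hcon (1 / (n + 1 : ℝ)) Nat.one_div_pos_of_nat
  have hg0 : Tendsto g atTop (𝓝 0) :=
    squeeze_zero_norm (fun n => (hg n).le) tendsto_one_div_add_atTop_nhds_zero_nat
  -- Projecting to a complement of the lineality space keeps the elements short, nonzero and in `K`.
  -- A limit of their directions then lies in both the lineality space and its complement.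
  let π : E →ₗ[ℝ] E := V'.subtype ∘ₗ V'.projectionOnto _ hV'.symm
  have hπ : Continuous π := LinearMap.continuous_of_finiteDimensional π
  have hπV : ∀ x, x - π x ∈ lineality K := fun x => by
    have : V'.projectionOnto _ hV'.symm (x - π x) = 0 := by
      rw [map_sub, sub_eq_zero]
      exact (V'.projectionOnto_apply_left hV'.symm _).symm
    exact (V'.projectionOnto_apply_eq_zero_iff hV'.symm).1 this
  have hπV' : ∀ x, π x ∈ V' := fun x => (V'.projectionOnto _ hV'.symm x).2
  have hpK : ∀ n, π (g n) ∈ K := fun n => by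
    have := K.sub_mem (hgK n) (mem_of_mem_lineality (hπV (g n)))
    rwa [sub_sub_cancel] at this
  have hp0 : ∀ n, π (g n) ≠ 0 := fun n h => hgV n (by simpa [h] using hπV (g n))
  have hp : Tendsto (fun n => π (g n)) atTop (𝓝 0) := by
    have := (hπ.tendsto 0).comp hg0
    rwa [map_zero] at this
  have hsph : ∀ n, ‖π (g n)‖⁻¹ • π (g n) ∈ Metric.sphere (0 : E) 1 := fun n => by
    rw [mem_sphere_zero_iff_norm, norm_smul, norm_inv, norm_norm,
      inv_mul_cancel₀ (norm_ne_zero_iff.2 (hp0 n))]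
  obtain ⟨w, hw, φ, hφ, hlim⟩ := (isCompact_sphere (0 : E) 1).tendsto_subseq hsph
  have hwV : w ∈ lineality K := tendsto_smul_mem_of_tendsto_zero hK (fun n => hpK (φ n))
    (hp.comp hφ.tendsto_atTop) hlim
  have hwV' : w ∈ V' := (Submodule.closed_of_finiteDimensional V').mem_of_tendsto hlim
    (Eventually.of_forall fun n => V'.smul_mem _ (hπV' _))
  have : w = 0 := Submodule.disjoint_def.1 hV'.disjoint w hwV hwV'
  simp [this] at hw

theorem map_eq_of_map_le (L : E ≃ₗ[ℝ] E) {W : Submodule ℝ E}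
    (h : W.map (L : E →ₗ[ℝ] E) ≤ W) : W.map (L : E →ₗ[ℝ] E) = W :=
  Submodule.eq_of_le_of_finrank_eq h (LinearEquiv.finrank_map_eq L W)

theorem map_lineality_eq (L : E ≃ₗ[ℝ] E) {K : AddSubgroup E} (h : imageSubgroup L K ≤ K) :
    (lineality K).map (L : E →ₗ[ℝ] E) = lineality K := by
  refine map_eq_of_map_le L ?_
  rintro _ ⟨v, hv, rfl⟩ t
  exact h ⟨t • v, hv t, by simp⟩

theorem lineality_le_imageSubgroup (L : E ≃ₗ[ℝ] E) {K : AddSubgroup E}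
    (h : imageSubgroup L K ≤ K) {v : E} (hv : v ∈ lineality K) : v ∈ imageSubgroup L K := by
  rw [← map_lineality_eq L h] at hv
  obtain ⟨w, hw, rfl⟩ := hv
  exact ⟨w, mem_of_mem_lineality hw, rfl⟩

/-- An `L`-invariant subgroup lies within bounded distance of its image. -/
theorem exists_norm_sub_le_of_imageSubgroup_le (L : E ≃ₗ[ℝ] E) {K : AddSubgroup E}
    (h : imageSubgroup L K ≤ K) :
    ∃ C : ℝ, ∀ g ∈ K, ∃ g' ∈ imageSubgroup L K, ‖g - g'‖ ≤ C := by
  obtain ⟨b, hbK, hspan, hli⟩ := exists_linearIndependent ℝ (K : Set E)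
  have hbf : b.Finite := hli.setFinite
  lift b to Finset E using hbf
  refine ⟨∑ x ∈ b, ‖L x‖, fun g hg => ?_⟩
  have hinv : (Submodule.span ℝ (K : Set E)).map (L : E →ₗ[ℝ] E) = Submodule.span ℝ (K : Set E) := by
    refine map_eq_of_map_le L ?_
    rw [Submodule.map_span, Submodule.span_le]
    rintro _ ⟨x, hx, rfl⟩
    exact Submodule.subset_span (h ⟨x, hx, rfl⟩)
  have hgs : g ∈ Submodule.span ℝ (K : Set E) := Submodule.subset_span hg
  rw [← hinv, ← hspan] at hgs
  obtain ⟨w, hw, rfl⟩ := hgs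
  obtain ⟨a, -, rfl⟩ := Submodule.mem_span_finset.1 hw
  -- Since `L` maps the span of `K` onto itself, `g` is the image of a real combination of elements
  -- of `K`; its coefficients are rounded down.
  refine ⟨L (∑ x ∈ b, ⌊a x⌋ • x), ⟨_, K.sum_mem fun x hx => K.zsmul_mem (hbK hx) _, rfl⟩, ?_⟩
  have : (L : E →ₗ[ℝ] E) (∑ x ∈ b, a x • x) - L (∑ x ∈ b, ⌊a x⌋ • x) =
      ∑ x ∈ b, Int.fract (a x) • L x := by
    rw [LinearEquiv.coe_coe, map_sum, map_sum, ← Finset.sum_sub_distrib]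
    refine Finset.sum_congr rfl fun x _ => ?_
    rw [map_smul, map_zsmul, ← Int.cast_smul_eq_zsmul ℝ, ← sub_smul, Int.self_sub_floor]
  rw [this]
  refine (norm_sum_le _ _).trans (Finset.sum_le_sum fun x _ => ?_)
  rw [norm_smul, Real.norm_of_nonneg (Int.fract_nonneg _)]
  exact mul_le_of_le_one_left (norm_nonneg _) (Int.fract_lt_one _).le

/-- Each coset has a representative in a fixed ball. Two that are closer than `ρ` differ by an
element of the lineality space, which lies in `L K`, so finitely many small balls separate the
cosets. -/
theorem finite_quotient_imageSubgroup (L : E ≃ₗ[ℝ] E) {K : AddSubgroup E}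
    (hK : IsClosed (K : Set E)) (h : imageSubgroup L K ≤ K) :
    Finite (K ⧸ (imageSubgroup L K).addSubgroupOf K) := by
  have : ProperSpace E := FiniteDimensional.proper ℝ E
  obtain ⟨ρ, hρ, hsmall⟩ := exists_forall_norm_lt_mem_lineality hK
  obtain ⟨C, hC⟩ := exists_norm_sub_le_of_imageSubgroup_le L h
  obtain ⟨t, -, htf, ht⟩ := (isCompact_closedBall (0 : E) C).finite_cover_balls (half_pos hρ)
  have hrep : ∀ q : K ⧸ (imageSubgroup L K).addSubgroupOf K, ∃ g : K, (g : K ⧸ _) = q ∧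
      ∃ z : t, dist (g : E) z < ρ / 2 := by
    intro q
    induction q using QuotientAddGroup.induction_on with
    | H g =>
      obtain ⟨g', hg', hn⟩ := hC g g.2
      refine ⟨g - ⟨g', h hg'⟩, ?_, ?_⟩
      · rw [QuotientAddGroup.eq]
        have : -(g - ⟨g', h hg'⟩) + g = (⟨g', h hg'⟩ : K) := by abel
        rw [this]
        exact hg'
      · obtain ⟨z, hz, hgz⟩ := Set.mem_iUnion₂.1 (ht (by simpa using hn : (g : E) - g' ∈ _))
        exact ⟨⟨z, hz⟩, hgz⟩
  choose r hr z hz using hrep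
  have := htf.to_subtype
  refine Finite.of_injective z fun q q' hqq => ?_
  rw [← hr q, ← hr q', QuotientAddGroup.eq]
  have h1 := hz q
  have h2 := hz q'
  rw [← hqq] at h2
  have h3 := dist_triangle_right (r q' : E) (r q) (z q)
  rw [dist_eq_norm] at h3
  have hmem := lineality_le_imageSubgroup L h
    (hsmall ((r q' : E) - r q) (K.sub_mem (r q').2 (r q).2) (by linarith))
  show -(r q : E) + r q' ∈ imageSubgroup L K
  rwa [neg_add_eq_sub]

theorem relIndex_imageSubgroup_ne_zero (L : E ≃ₗ[ℝ] E) {K : AddSubgroup E}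
    (hK : IsClosed (K : Set E)) (h : imageSubgroup L K ≤ K) :
    (imageSubgroup L K).relIndex K ≠ 0 :=
  have := finite_quotient_imageSubgroup L hK h
  AddSubgroup.index_ne_zero_of_finite

/-- A closed subgroup has trivial discrete component iff it is a linear subspace. -/
theorem hasTrivialDiscreteComponent_iff {K : AddSubgroup E} (hK : IsClosed (K : Set E)) :
    HasTrivialDiscreteComponent K ↔ ∀ g ∈ K, g ∈ lineality K := by
  rw [HasTrivialDiscreteComponent, QuotientAddGroup.subsingleton_iff, AddSubgroup.eq_top_iff']
  constructor
  · intro h g hg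
    obtain ⟨ρ, hρ, hsmall⟩ := exists_forall_norm_lt_mem_lineality hK
    -- The lineality space is open and closed in `K`, so it contains the identity component.
    let V : AddSubgroup K := (lineality K).toAddSubgroup.addSubgroupOf K
    have hopen : IsOpen (V : Set K) := by
      refine V.isOpen_of_mem_nhds (g := 0) (Metric.mem_nhds_iff.2 ⟨ρ, hρ, fun x hx => ?_⟩)
      refine hsmall x x.2 ?_
      simpa using hx
    have hclopen : IsClopen (V : Set K) := ⟨V.isClosed_of_isOpen hopen, hopen⟩
    exact hclopen.connectedComponent_subset V.zero_mem (h ⟨g, hg⟩)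
  · intro h g
    let γ : ℝ → K := fun t => ⟨t • (g : E), h g g.2 t⟩
    have hγ : Continuous γ := by
      refine Continuous.subtype_mk ?_ _
      fun_prop
    have h0 : (0 : K) ∈ Set.range γ := ⟨0, Subtype.ext (zero_smul ℝ _)⟩
    have h1 : g ∈ Set.range γ := ⟨1, Subtype.ext (one_smul ℝ _)⟩
    exact (isPreconnected_range hγ).subset_connectedComponent h0 h1

/-- If `L K = K`, every `g ∈ K` can be pulled back inside `K` until it is short, hence in the
lineality space, which is `L`-invariant. -/
theorem hasTrivialDiscreteComponent_iff_relIndex_eq_one {L : E ≃ₗ[ℝ] E} {K : AddSubgroup E}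
    (hK : IsClosed (K : Set E)) (h : imageSubgroup L K ≤ K)
    (hL : ∀ x, Tendsto (fun m : ℕ => (L ^ m).symm x) atTop (𝓝 0)) :
    HasTrivialDiscreteComponent K ↔ (imageSubgroup L K).relIndex K = 1 := by
  rw [hasTrivialDiscreteComponent_iff hK, AddSubgroup.relIndex_eq_one]
  constructor
  · exact fun hV g hg => lineality_le_imageSubgroup L h (hV g hg)
  · intro hKL g hg
    obtain ⟨ρ, hρ, hsmall⟩ := exists_forall_norm_lt_mem_lineality hK
    have hinv : ∀ m : ℕ, (L ^ m).symm g ∈ K := by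
      intro m
      induction m with
      | zero => exact hg
      | succ m ih =>
        have := mem_imageSubgroup_iff_symm.1 (hKL ih)
        rwa [pow_succ]
    obtain ⟨m, hm⟩ := ((hL g).eventually (Metric.ball_mem_nhds 0 hρ)).exists
    have hmV : (L ^ m).symm g ∈ lineality K := hsmall _ (hinv m) (by simpa using hm)
    have hLV : ∀ m : ℕ, ∀ v ∈ lineality K, (L ^ m) v ∈ lineality K := by
      intro m
      induction m with
      | zero => exact fun v hv => hv
      | succ m ih =>
        intro v hv
        rw [pow_succ']
        have : L ((L ^ m) v) ∈ (lineality K).map (L : E →ₗ[ℝ] E) := ⟨_, ih v hv, rfl⟩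
        rwa [map_lineality_eq L h] at this
    simpa using hLV m _ hmV

end ClosedSubgroups

/-! ### Expansive maps have inverses with contracting powers -/

section Expansive

open Filter

/-- Gelfand's formula bounds `‖a ^ n‖` eventually by `r ^ n` with `r < 1`. -/
theorem tendsto_pow_zero_of_spectralRadius_lt_one {R : Type*} [NormedRing R] [NormedAlgebra ℂ R]
    [CompleteSpace R] {a : R} (h : spectralRadius ℂ a < 1) :
    Tendsto (fun n : ℕ => a ^ n) atTop (𝓝 0) := by
  obtain ⟨r, hr, hr1⟩ := ENNReal.lt_iff_exists_nnreal_btwn.1 h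
  have hr1' : r < 1 := by exact_mod_cast hr1
  have hev := (spectrum.pow_nnnorm_pow_one_div_tendsto_nhds_spectralRadius a).eventually_lt_const hr
  have hbound : ∀ᶠ n : ℕ in atTop, ‖a ^ n‖ ≤ (r : ℝ) ^ n := by
    filter_upwards [hev, eventually_gt_atTop 0] with n hn hn0
    have hn' : (0 : ℝ) < n := by exact_mod_cast hn0
    have h1 := ENNReal.rpow_le_rpow hn.le hn'.le
    rw [← ENNReal.rpow_mul, one_div_mul_cancel hn'.ne', ENNReal.rpow_one,
      ENNReal.rpow_natCast] at h1
    exact_mod_cast h1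
  exact squeeze_zero_norm' hbound (tendsto_pow_atTop_nhds_zero_of_lt_one r.2 (by exact_mod_cast hr1'))

variable {E : Type*} [NormedAddCommGroup E] [NormedSpace ℝ E] [FiniteDimensional ℝ E]

open scoped TensorProduct in
theorem IsExpansive.norm_lt_one_of_mem_spectrum {L : E ≃ₗ[ℝ] E} (hL : IsExpansive L) {z : ℂ}
    (hz : z ∈ spectrum ℂ
      (LinearMap.baseChange ℂ (L.symm : E →ₗ[ℝ] E) : Module.End ℂ (ℂ ⊗[ℝ] E))) : ‖z‖ < 1 := by
  rw [← Module.End.hasEigenvalue_iff_mem_spectrum] at hz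
  obtain ⟨v, hv⟩ := hz.exists_hasEigenvector
  have hG := hv.apply_eq_smul
  have hinv : LinearMap.baseChange ℂ (L : E →ₗ[ℝ] E)
      (LinearMap.baseChange ℂ (L.symm : E →ₗ[ℝ] E) v) = v := by
    rw [← LinearMap.comp_apply, ← LinearMap.baseChange_comp]
    simp
  rw [hG, map_smul] at hinv
  have hz0 : z ≠ 0 := by
    rintro rfl
    rw [zero_smul] at hinv
    exact hv.2 hinv.symm
  have hF : Module.End.HasEigenvalue
      (LinearMap.baseChange ℂ (L : E →ₗ[ℝ] E) : Module.End ℂ (ℂ ⊗[ℝ] E)) z⁻¹ := by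
    refine Module.End.hasEigenvalue_of_hasEigenvector (x := v)
      ⟨Module.End.mem_eigenspace_iff.2 ?_, hv.2⟩
    rw [eq_inv_smul_iff₀ hz0]
    exact hinv
  have := hL _ hF
  rw [norm_inv] at this
  exact (one_lt_inv₀ (norm_pos_iff.2 hz0)).1 this

-- Gelfand's formula needs complex scalars, so the real matrix is complexified. Convergence is
-- stated entrywise, which keeps the auxiliary matrix norm out of the statement.
attribute [local instance] Matrix.linftyOpNormedRing Matrix.linftyOpNormedAlgebra in
theorem IsExpansive.tendsto_toMatrix_symm_pow {L : E ≃ₗ[ℝ] E} (hL : IsExpansive L) [Nontrivial E]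
    (i j : Fin (Module.finrank ℝ E)) :
    Tendsto (fun n : ℕ => (LinearMap.toMatrix (Module.finBasis ℝ E) (Module.finBasis ℝ E)
      (L.symm : E →ₗ[ℝ] E) ^ n) i j) atTop (𝓝 0) := by
  set b := Module.finBasis ℝ E
  set M := LinearMap.toMatrix b b (L.symm : E →ₗ[ℝ] E)
  have : Nonempty (Fin (Module.finrank ℝ E)) := ⟨i⟩
  have : CompleteSpace (Matrix (Fin (Module.finrank ℝ E)) (Fin (Module.finrank ℝ E)) ℂ) :=
    FiniteDimensional.complete ℂ _
  have hspec : spectralRadius ℂ (M.map (algebraMap ℝ ℂ)) < 1 := by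
    refine spectrum.spectralRadius_lt_of_forall_lt (r := 1) _ fun z hz => ?_
    rw [← LinearMap.toMatrix_baseChange] at hz
    have e := AlgEquiv.spectrum_eq (LinearMap.toMatrixAlgEquiv (Algebra.TensorProduct.basis ℂ b))
      (LinearMap.baseChange ℂ (L.symm : E →ₗ[ℝ] E))
    have hz' : z ∈ spectrum ℂ (LinearMap.baseChange ℂ (L.symm : E →ₗ[ℝ] E)) := by
      rw [← e]; exact hz
    exact hL.norm_lt_one_of_mem_spectrum hz'
  have hlim := tendsto_pow_zero_of_spectralRadius_lt_one hspec
  have hentry : Continuous fun N : Matrix (Fin (Module.finrank ℝ E)) (Fin (Module.finrank ℝ E)) ℂ =>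
      (N i j).re := by
    let ℓ : Matrix (Fin (Module.finrank ℝ E)) (Fin (Module.finrank ℝ E)) ℂ →ₗ[ℂ] ℂ :=
      Matrix.entryLinearMap ℂ ℂ i j
    exact Complex.continuous_re.comp (LinearMap.continuous_of_finiteDimensional ℓ)
  have h := (hentry.tendsto 0).comp hlim
  simp only [Matrix.zero_apply, Complex.zero_re] at h
  refine h.congr fun n => ?_
  have : M.map (algebraMap ℝ ℂ) ^ n = (M ^ n).map (algebraMap ℝ ℂ) :=
    (map_pow (algebraMap ℝ ℂ).mapMatrix M n).symm
  simp only [Function.comp_apply, this]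
  simp

theorem IsExpansive.exists_norm_pow_symm_le {L : E ≃ₗ[ℝ] E} (hL : IsExpansive L) :
    ∃ k₀ : ℕ, ∀ k ≥ k₀, ∀ x : E, ‖(L ^ k).symm x‖ ≤ ‖x‖ / 2 := by
  cases subsingleton_or_nontrivial E with
  | inl _ => exact ⟨0, fun k _ x => by simp [Subsingleton.elim x 0]⟩
  | inr _ =>
    set b := Module.finBasis ℝ E
    let T : ℕ → E →L[ℝ] E := fun k => LinearMap.toContinuousLinearMap ((L ^ k).symm : E →ₗ[ℝ] E)
    let Ψ : Matrix (Fin (Module.finrank ℝ E)) (Fin (Module.finrank ℝ E)) ℝ →ₗ[ℝ] (E →L[ℝ] E) :=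
      (LinearMap.toContinuousLinearMap : (E →ₗ[ℝ] E) ≃ₗ[ℝ] _).toLinearMap ∘ₗ
        (Matrix.toLin b b).toLinearMap
    have hΨ : Continuous Ψ := LinearMap.continuous_of_finiteDimensional Ψ
    have hlim : Tendsto (fun n : ℕ => LinearMap.toMatrix b b (L.symm : E →ₗ[ℝ] E) ^ n) atTop
        (𝓝 0) := tendsto_pi_nhds.2 fun i => tendsto_pi_nhds.2 fun j =>
      hL.tendsto_toMatrix_symm_pow i j
    have hT : Tendsto T atTop (𝓝 0) := by
      have h := (hΨ.tendsto 0).comp hlim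
      rw [map_zero] at h
      refine h.congr fun n => ?_
      have hpow : ((L ^ n).symm : E →ₗ[ℝ] E) = (L.symm : E →ₗ[ℝ] E) ^ n := by
        induction n with
        | zero => rfl
        | succ n ih =>
          rw [pow_succ' (L.symm : E →ₗ[ℝ] E), ← ih, pow_succ]
          rfl
      show LinearMap.toContinuousLinearMap (Matrix.toLin b b (LinearMap.toMatrix b b _ ^ n)) = _
      rw [LinearMap.toMatrix_pow, Matrix.toLin_toMatrix, ← hpow]
    have hev := (tendsto_zero_iff_norm_tendsto_zero.1 hT).eventually_le_const
      (show (0 : ℝ) < 1 / 2 by norm_num)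
    obtain ⟨k₀, hk₀⟩ := eventually_atTop.1 hev
    refine ⟨k₀, fun k hk x => ((T k).le_opNorm x).trans ?_⟩
    linarith [mul_le_mul_of_nonneg_right (hk₀ k hk) (norm_nonneg x)]

end Expansive

end EuclideanPattern

namespace EuclideanPattern

/-! ### Closedness of periods and finiteness of LI-classes -/

section LIClasses

open Filter

variable {E : Type*} [NormedAddCommGroup E] {A : Type*} {Ω : Set (E → A)} {f : Ω → Ω}

theorem IsPatternSpace.shift_mem (hΩ : IsPatternSpace Ω) {P : E → A} (hP : P ∈ Ω) (g : E) :
    (fun x => P (x + g)) ∈ Ω :=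
  hΩ.2 _ fun x _ _ => ⟨P, hP, x + g, patch_eq_patch_iff.2 fun u _ => by rw [add_right_comm]⟩

/-- The periods of an element of a well-separated space form a closed group. -/
theorem isClosed_periods (hΩ : IsPatternSpace Ω) (hsep : IsWellSeparated Ω) {P : E → A}
    (hP : P ∈ Ω) : IsClosed (periods P : Set E) := by
  obtain ⟨V, -, hV⟩ := hsep
  refine isClosed_of_closure_subset fun g hg => ?_
  by_contra hgP
  rw [SetLike.mem_coe, mem_periods_iff] at hgP
  push Not at hgP
  obtain ⟨x, hx⟩ := hgP
  obtain ⟨N, hN, h⟩ := hV (fun y => P (y + (x + g))) (hΩ.shift_mem hP _) (fun y => P (y + x))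
    (hΩ.shift_mem hP _) (by simpa using hx)
  have hN' : (fun k => k - g) ⁻¹' N ∈ 𝓝 g :=
    (continuous_id.sub continuous_const).continuousAt.preimage_mem_nhds (by simpa using hN)
  obtain ⟨k, hkN, hk⟩ := mem_closure_iff_nhds.1 hg _ hN'
  -- A period `k` close to `g` makes the two shifts of `P` coincide after the small displacement `k
  -- - g`, against separation.
  refine h (k - g) hkN 0 (mem_of_mem_nhds hN) (patch_eq_patch_iff.2 fun u _ => ?_)
  have := mem_periods_iff.1 hk (0 + u + x)
  rw [← this]
  congr 1
  abel

/-- The map induced on the finite set of LI-classes is onto, hence a permutation of finite order. -/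
theorem exists_iterate_fixesLIClasses {M : ℕ} {Φ : Ω → Set (Fin M)}
    (hΦ : ∀ Q Q' : Ω, Φ Q = Φ Q' → LocallyIndistinguishable (Q : E → A) Q')
    (hf : Function.Surjective f)
    (hmap : ∀ P Q : Ω, LocallyIndistinguishable (P : E → A) Q →
      LocallyIndistinguishable (f P : E → A) (f Q)) :
    ∃ n : ℕ, 0 < n ∧ FixesLIClasses f^[n] := by
  let s : Setoid Ω :=
    { r := fun P Q => LocallyIsomorphic (P : E → A) Q
      iseqv := ⟨fun P => ⟨.refl _, .refl _⟩, fun h => h.symm, fun h h' => h.trans h'⟩ }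
  have hfin : Finite (Quotient s) := by
    refine Finite.of_injective (fun q : Quotient s => Φ q.out) fun q q' h => ?_
    rw [← Quotient.out_eq q, ← Quotient.out_eq q']
    exact Quotient.sound ⟨hΦ _ _ h, hΦ _ _ h.symm⟩
  let F : Quotient s → Quotient s :=
    Quotient.map f fun P Q h => ⟨hmap P Q h.1, hmap Q P h.2⟩
  have hF : Function.Semiconj (Quotient.mk s) f F := fun P => rfl
  have hFs : Function.Surjective F := by
    intro q
    induction q using Quotient.inductionOn with
    | h P =>
      obtain ⟨Q, rfl⟩ := hf P
      exact ⟨⟦Q⟧, rfl⟩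
  let e : Equiv.Perm (Quotient s) :=
    Equiv.ofBijective F ⟨Finite.injective_iff_surjective.2 hFs, hFs⟩
  obtain ⟨n, hn, he⟩ := (isOfFinOrder_iff_pow_eq_one.1 (isOfFinOrder_of_finite e))
  refine ⟨n, hn, fun P => Quotient.exact (s := s) ?_⟩
  rw [(hF.iterate_right n) P]
  have h := congrArg (fun g : Equiv.Perm (Quotient s) => g ⟦P⟧) he
  rwa [← Equiv.Perm.iterate_eq_pow] at h

variable [NormedSpace ℝ E] [FiniteDimensional ℝ E] {L : E ≃ₗ[ℝ] E} {c : ℝ}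

/-- LI-classes are determined by a finite amount of information. -/
theorem Propagates.exists_finite_invariant (hp : Propagates L c f) (hc : 0 ≤ c) (hFLC : IsFLC Ω)
    (hL : ∀ x, ‖L.symm x‖ ≤ ‖x‖ / 2) (hf : Function.Surjective f) :
    ∃ (M : ℕ) (Φ : Ω → Set (Fin M)), ∀ Q Q' : Ω, Φ Q = Φ Q' →
      LocallyIndistinguishable (Q : E → A) Q' := by
  obtain ⟨M, τ, hτ⟩ := hp.exists_types hc hFLC 1 one_pos
  choose H hH0 hH using exists_history hf
  -- The invariant is the set of types occurring in the history for ultrafilter-many `m`. An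
  -- ultrafilter decides each type, so for equal invariants some large `m` has every type of `H Q m`
  -- occurring in `H Q' m`; inflating by `f^[m]` carries this to patches of any radius.
  refine ⟨M, fun Q => {i | ∀ᶠ m in (hyperfilter ℕ : Filter ℕ), ∃ x, τ (H Q m) x = i},
    fun Q Q' hQ => locallyIndistinguishable_of_forall_norm_le fun r x => ?_⟩
  have hev : ∀ᶠ m in (hyperfilter ℕ : Filter ℕ), ∀ i,
      (∃ x, τ (H Q m) x = i) → ∃ x, τ (H Q' m) x = i := by
    refine eventually_all.2 fun i => ?_
    rw [Ultrafilter.eventually_imp]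
    intro hi
    exact hQ.le hi
  obtain ⟨m₀, hm₀⟩ := exists_norm_pow_symm_le hL r
  obtain ⟨m, hm, hm'⟩ := (hev.and (Nat.hyperfilter_le_atTop (eventually_ge_atTop m₀))).exists
  obtain ⟨z, hz⟩ := hm _ ⟨(L ^ m).symm x, rfl⟩
  obtain ⟨θ, -, hθ⟩ := hτ _ _ _ _ hz.symm
  refine ⟨(L ^ m) (z + θ), fun u hu => ?_⟩
  have key := hθ m ((L ^ m).symm u) (hm₀ m hm' u hu)
  rw [show f^[m] (H Q m) = Q from (hH Q m 0).trans (hH0 Q),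
    show f^[m] (H Q' m) = Q' from (hH Q' m 0).trans (hH0 Q'), ← add_assoc] at key
  simpa using key

end LIClasses

/-! ### Fibres of substitutions -/

section Substitutions

open Filter

variable {E : Type*} [NormedAddCommGroup E] [NormedSpace ℝ E] {A : Type*}
  {L : E ≃ₗ[ℝ] E} {Ω : Set (E → A)} {f : Ω → Ω} {c : ℝ}

theorem substitution_surjective {S : inflate L Ω → Ω} (hS : Function.Surjective S) :
    Function.Surjective (substitution L S) := by
  intro P
  obtain ⟨⟨_, Q, hQ, rfl⟩, h⟩ := hS P
  exact ⟨⟨Q, hQ⟩, h⟩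

variable [FiniteDimensional ℝ E]

theorem exists_hasLocalRule_substitution {S : inflate L Ω → Ω} (hS : IsLDMap S) :
    ∃ c : ℝ, 0 ≤ c ∧ HasLocalRule L c (substitution L S) := by
  obtain ⟨c, hc, h⟩ := hS
  let T : E →L[ℝ] E := LinearMap.toContinuousLinearMap (L.symm : E →ₗ[ℝ] E)
  refine ⟨‖T‖ * c, by positivity, fun P Q x y H => ?_⟩
  refine h _ _ _ _ (patch_closedBall_eq_iff.2 fun u hu => ?_)
  have := H (L.symm u) ((T.le_opNorm u).trans (mul_le_mul_of_nonneg_left hu (norm_nonneg _)))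
  simpa [distort] using this

theorem IsExpansive.exists_iterate_propagates (hL : IsExpansive L) (hf : HasLocalRule L c f)
    (hc : 0 ≤ c) : ∃ k₀ : ℕ, ∀ k ≥ k₀, (∀ x, ‖(L ^ k).symm x‖ ≤ ‖x‖ / 2) ∧
      ∃ c' : ℝ, 0 ≤ c' ∧ Propagates (L ^ k) c' f^[k] := by
  obtain ⟨k₀, hk₀⟩ := hL.exists_norm_pow_symm_le
  refine ⟨k₀, fun k hk => ⟨hk₀ k hk, ?_⟩⟩
  obtain ⟨c', hc', h⟩ := hf.exists_iterate hc k
  exact ⟨2 * c', by positivity, h.propagates (hk₀ k hk)⟩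

/-- `L ^ n` itself need not have a contracting inverse, so exponents are divided by `k + 1`, a
positive exponent for which contraction holds. -/
theorem IsExpansive.tendsto_pow_symm (hL : IsExpansive L) {n : ℕ} (hn : 0 < n) (x : E) :
    Tendsto (fun m : ℕ => ((L ^ n) ^ m).symm x) atTop (𝓝 0) := by
  obtain ⟨k, hk⟩ := hL.exists_norm_pow_symm_le
  obtain ⟨B, hB⟩ := exists_pow_bound L.symm k
  have hlin : ∀ i : ℕ, (L ^ i).symm = L.symm ^ i := fun i => by
    induction i with
    | zero => rfl
    | succ i ih => rw [pow_succ', pow_succ, ← ih]; rfl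
  have hbound : ∀ i : ℕ, ‖(L ^ i).symm x‖ ≤ B * (‖x‖ / 2 ^ (i / (k + 1))) := by
    intro i
    have hq : ∀ q r : ℕ, (L ^ ((k + 1) * q + r)).symm x =
        (L.symm ^ r) (((L ^ (k + 1)) ^ q).symm x) := fun q r => by
      rw [pow_add, pow_mul, ← hlin r]; rfl
    have hi := hq (i / (k + 1)) (i % (k + 1))
    rw [Nat.div_add_mod] at hi
    rw [hi]
    exact (hB.2 _ (Nat.lt_succ_iff.1 (Nat.mod_lt _ k.succ_pos)) _).trans
      (mul_le_mul_of_nonneg_left (norm_pow_symm_le (hk (k + 1) k.le_succ) _ x)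
        (zero_le_one.trans hB.1))
  have hlim : Tendsto (fun i : ℕ => B * (‖x‖ / 2 ^ (i / (k + 1)))) atTop (𝓝 0) := by
    have h2 : Tendsto (fun j : ℕ => (2 : ℝ) ^ j) atTop atTop :=
      tendsto_pow_atTop_atTop_of_one_lt one_lt_two
    have h := ((h2.comp (Nat.tendsto_div_const_atTop k.succ_ne_zero)).const_div_atTop
      ‖x‖).const_mul B
    rwa [mul_zero] at h
  have h0 : Tendsto (fun i : ℕ => (L ^ i).symm x) atTop (𝓝 0) := squeeze_zero_norm hbound hlim
  have h1 := h0.comp (tendsto_id.const_mul_atTop' hn)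
  refine h1.congr fun m => ?_
  simp only [Function.comp_apply, id, pow_mul]

/-- Predecessors under any iterate are unique up to translation. -/
theorem exists_translation_of_iterate_eq (hL : IsExpansive L) (hFLC : IsFLC Ω)
    (hf : HasLocalRule L c f) (hc : 0 ≤ c) (hsurj : Function.Surjective f) {n : ℕ} (hn : 0 < n)
    (hfix : FixesLIClasses f^[n]) {m : ℕ} {Q Q' : Ω} (hQ : f^[m] Q = f^[m] Q') :
    ∃ h : E, ∀ x, (Q : E → A) x = (Q' : E → A) (x + h) := by
  obtain ⟨k₀, hk₀⟩ := hL.exists_iterate_propagates hf hc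
  -- The exponent `n * (k₀ + m)` is a multiple of `n`, so LI-classes are fixed; it is at least `k₀`,
  -- for contraction, and at least `m`, so `Q` and `Q'` have merged.
  have hN : k₀ + m ≤ n * (k₀ + m) := Nat.le_mul_of_pos_left _ hn
  obtain ⟨hLN, c', hc', hp⟩ := hk₀ (n * (k₀ + m)) (by omega)
  have hfix' : FixesLIClasses f^[n * (k₀ + m)] := by
    rw [Function.iterate_mul]
    exact hfix.iterate _
  refine hp.exists_translation_of_apply_eq hc' hFLC hLN (hsurj.iterate _) hfix' ?_
  obtain ⟨i, hi⟩ := Nat.exists_eq_add_of_le' (show m ≤ n * (k₀ + m) by omega)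
  rw [hi, Function.iterate_add_apply, hQ, ← Function.iterate_add_apply]

theorem imageSubgroup_periods_le (hf : HasLocalRule L c f) (hfix : FixesLIClasses f) (P : Ω) :
    imageSubgroup L (periods (P : E → A)) ≤ periods (P : E → A) := by
  rintro _ ⟨g, hg, rfl⟩
  rw [← (hfix P).periods_eq, mem_periods_iff]
  intro x
  exact (hf.map_apply_of_shift (fun x => (mem_periods_iff.1 hg x).symm) x).symm

theorem isLSubPattern_of_fixes (hf : HasLocalRule L c f) (hc : 0 ≤ c) (hfix : FixesLIClasses f)
    (hsurj : Function.Surjective f) (P : Ω) : IsLSubPattern L (P : E → A) := by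
  obtain ⟨Q, rfl⟩ := hsurj P
  let T : E →L[ℝ] E := LinearMap.toContinuousLinearMap (L : E →ₗ[ℝ] E)
  refine ⟨Q, (hfix Q).2, ‖T‖ * c, by positivity, fun x y h => ?_⟩
  have key := hf Q Q (L.symm x) (L.symm y) fun u hu => by
    have := patch_closedBall_eq_iff.1 h (L u)
      ((T.le_opNorm u).trans (mul_le_mul_of_nonneg_left hu (norm_nonneg _)))
    simpa [distort] using this
  simpa using key

/-- The fibres of `f` are torsors under `K / L K`, where `K` is the group of periods. -/
theorem encard_fibre (hΩ : IsPatternSpace Ω) (hsep : IsWellSeparated Ω) (hf : HasLocalRule L c f)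
    (hfix : FixesLIClasses f) (hsurj : Function.Surjective f)
    (htrans : ∀ Q Q' : Ω, f Q = f Q' → ∃ h : E, ∀ x, (Q : E → A) x = (Q' : E → A) (x + h))
    (P : Ω) :
    {Q : Ω | f Q = P}.encard =
      ((imageSubgroup L (periods (P : E → A))).relIndex (periods (P : E → A)) : ℕ∞) := by
  obtain ⟨Q₀, rfl⟩ := hsurj P
  set K := periods (f Q₀ : E → A) with hK
  have hfin := finite_quotient_imageSubgroup L (isClosed_periods hΩ hsep (f Q₀).2)
    (imageSubgroup_periods_le hf hfix (f Q₀))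
  have hKQ : K = periods (Q₀ : E → A) := (hfix Q₀).periods_eq
  -- Shifting `Q₀` by `L⁻¹ g` shifts its image by the period `g`, so it stays in the fibre.
  -- Recognizability makes `ψ` onto, and since `Q₀` also has period group `K`, two values agree
  -- exactly modulo `L K`.
  let ψ : K → {Q : Ω | f Q = f Q₀} := fun g =>
    ⟨⟨fun x => (Q₀ : E → A) (x + L.symm g), hΩ.shift_mem Q₀.2 _⟩, by
      refine Subtype.ext (funext fun x => ?_)
      rw [hf.map_apply_of_shift (Q := Q₀) (g := L.symm g) (fun x => rfl) x,
        LinearEquiv.apply_symm_apply]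
      exact mem_periods_iff.1 g.2 x⟩
  have hψ : Function.Surjective ψ := by
    rintro ⟨Q, hQ⟩
    obtain ⟨h, hh⟩ := htrans Q Q₀ hQ
    refine ⟨⟨L h, mem_periods_iff.2 fun x => ?_⟩, Subtype.ext (Subtype.ext (funext fun x => ?_))⟩
    · rw [← hf.map_apply_of_shift hh x]
      exact congrFun (congrArg Subtype.val hQ) x
    · show (Q₀ : E → A) (x + L.symm (L h)) = _
      rw [LinearEquiv.symm_apply_apply, hh]
  have hmem : ∀ v, v ∈ K ↔ ∀ x, (Q₀ : E → A) (x + v) = (Q₀ : E → A) x := fun v => by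
    rw [hKQ, mem_periods_iff]
  have hker : ∀ g g' : K, QuotientAddGroup.leftRel ((imageSubgroup L K).addSubgroupOf K) g g' ↔
      Setoid.ker ψ g g' := by
    intro g g'
    rw [QuotientAddGroup.leftRel_apply, Setoid.ker_def, AddSubgroup.mem_addSubgroupOf,
      mem_imageSubgroup_iff_symm, hmem, Subtype.ext_iff, Subtype.ext_iff,
      funext_iff]
    show (∀ x, (Q₀ : E → A) (x + L.symm (-(g : E) + g')) = Q₀.1 x) ↔
      ∀ x, Q₀.1 (x + L.symm g) = Q₀.1 (x + L.symm g')
    constructor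
    · intro h x
      rw [← h, add_assoc, ← map_add, add_neg_cancel_left]
    · intro h x
      have := h (x - L.symm g)
      rw [sub_add_cancel] at this
      rw [this, map_add, map_neg,
        show x - L.symm g + L.symm g' = x + (-L.symm g + L.symm g') by abel]
  let e : (K ⧸ (imageSubgroup L K).addSubgroupOf K) ≃ {Q : Ω | f Q = f Q₀} :=
    (Quotient.congrRight hker).trans (Setoid.quotientKerEquivOfSurjective ψ hψ)
  rw [Set.encard, ← ENat.card_congr e, ENat.card_eq_coe_natCard]
  rfl

end Substitutions

end EuclideanPattern

/-! ### The main theorem -/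

theorem theorem4p6 {E : Type*} [NormedAddCommGroup E] [NormedSpace ℝ E] [FiniteDimensional ℝ E]
    {A : Type*} (L : E ≃ₗ[ℝ] E) (hL : IsExpansive L)
    (Ω : Set (E → A)) (hΩ : IsPatternSpace Ω) (hFLC : IsFLC Ω) (hsep : IsWellSeparated Ω)
    (S : inflate L Ω → Ω) (hS : IsLDMap S) (hsurj : Function.Surjective S) :
    (∃ n : ℕ, 0 < n ∧ FixesLIClasses (substitution L S)^[n]) ∧
    (∀ n : ℕ, 0 < n → FixesLIClasses (substitution L S)^[n] →
      ∀ P : Ω,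
        IsLSubPattern (L ^ n) (P : E → A) ∧
        IsClosed (periods (P : E → A) : Set E) ∧
        imageSubgroup (L ^ n) (periods (P : E → A)) ≤ periods (P : E → A) ∧
        (imageSubgroup (L ^ n) (periods (P : E → A))).relIndex (periods (P : E → A)) ≠ 0 ∧
        {Q : Ω | (substitution L S)^[n] Q = P}.encard =
          ((imageSubgroup (L ^ n) (periods (P : E → A))).relIndex (periods (P : E → A)) : ℕ∞) ∧
        (HasTrivialDiscreteComponent (periods (P : E → A)) ↔
          ∃! Q : Ω, (substitution L S)^[n] Q = P)) ∧
    (∀ P : Ω, IsNonperiodic (P : E → A) → ∃! Q : Ω, substitution L S Q = P) := by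
  have hσ := substitution_surjective hsurj
  obtain ⟨c, hc, hrule⟩ := exists_hasLocalRule_substitution hS
  have hfixes : ∃ n : ℕ, 0 < n ∧ FixesLIClasses (substitution L S)^[n] := by
    obtain ⟨k₀, hk₀⟩ := hL.exists_iterate_propagates hrule hc
    obtain ⟨hLk, c', hc', hp⟩ := hk₀ k₀ le_rfl
    obtain ⟨M, Φ, hΦ⟩ := hp.exists_finite_invariant hc' hFLC hLk (hσ.iterate k₀)
    exact exists_iterate_fixesLIClasses hΦ hσ fun P Q h => hrule.locallyIndistinguishable h
  refine ⟨hfixes, fun n hn hfix P => ?_, fun P hP => ?_⟩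
  · obtain ⟨cn, hcn, hrulen⟩ := hrule.exists_iterate hc n
    have hclosed := isClosed_periods hΩ hsep P.2
    have hle := imageSubgroup_periods_le hrulen hfix P
    have hcard := encard_fibre hΩ hsep hrulen hfix (hσ.iterate n)
      (fun Q Q' h => exists_translation_of_iterate_eq hL hFLC hrule hc hσ hn hfix h) P
    refine ⟨isLSubPattern_of_fixes hrulen hcn hfix (hσ.iterate n) P, hclosed, hle,
      relIndex_imageSubgroup_ne_zero _ hclosed hle, hcard, ?_⟩
    rw [hasTrivialDiscreteComponent_iff_relIndex_eq_one hclosed hle (hL.tendsto_pow_symm hn),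
      ← Nat.cast_inj (R := ℕ∞), ← hcard, Nat.cast_one, Set.encard_eq_one]
    simp only [Set.eq_singleton_iff_unique_mem, Set.mem_ofPred_eq, ExistsUnique]
  · obtain ⟨n, hn, hfix⟩ := hfixes
    obtain ⟨Q, hQ⟩ := hσ P
    refine ⟨Q, hQ, fun Q' hQ' => ?_⟩
    -- The case `m = 1` handles the substitution itself, which need not fix LI-classes. The
    -- translation `h` has `L h` as a period of `P`, so it vanishes.
    obtain ⟨h, hh⟩ := exists_translation_of_iterate_eq hL hFLC hrule hc hσ hn hfix (m := 1)
      (Q := Q') (Q' := Q) (hQ'.trans hQ.symm)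
    have hper : L h ∈ periods (P : E → A) := mem_periods_iff.2 fun x => by
      have := hrule.map_apply_of_shift hh x
      rw [hQ', hQ] at this
      exact this.symm
    rw [show periods (P : E → A) = ⊥ from hP, AddSubgroup.mem_bot, L.map_eq_zero_iff] at hper
    exact Subtype.ext (funext fun x => by rw [hh, hper, add_zero])
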